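/- Work over $\mathbb{C}$. Let $g \ge 6$ and let $0 \le k_1 \le k_2 \le k_3$ be integers with $k_1+k_2+k_3 = g-3$. Let $X=\mathbb{P}(\mathcal{E})$, $\mathcal{E}=\mathcal{O}_{\mathbb{P}^1}(k_1)\oplus\mathcal{O}_{\mathbb{P}^1}(k_2)\oplus\mathcal{O}_{\mathbb{P}^1}(k_3)$, with projection $\pi:X\to\mathbb{P}^1$, tautological class $H$ (so that $\pi_*\mathcal{O}_X(H)=\mathcal{E}$) and fibre class $F$; it is mapped to $\mathbb{P}^{g-1}$ by the complete linear system $|H|$ as a rational normal scroll of dimension $3$ and degree $g-3$ (if $k_1=0$, the image is a cone; in that case divisors on $X$ are replaced below by their scheme-theoretic images in $\mathbb{P}^{g-1}$). Let $a,b$ be non-negative integers with $a+b=g-5$, let $Q_1\in|2H-aF|$ and $Q_2\in|2H-bF|$ be the divisors of nonzero sections, and assume that the scheme-theoretic intersection $C := Q_1\cap Q_2\subset X\subset\mathbb{P}^{g-1}$ is a nonsingular curve. Let $V$ be the space of linear forms on $\mathbb{P}^{g-1}$, let $I_{C,d}$ be the space of forms of degree $d$ in the homogeneous ideal of $C$,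 and let $K_{2,1}(C)=\ker\big(V\otimes I_{C,2}\to I_{C,3}\big)$ be the space of linear syzygies among the quadrics containing $C$. For $\gamma=\sum_i\ell_i\otimes q_i\in K_{2,1}(C)$ with linearly independent $\ell_i \in V$ and $q_i\in I_{C,2}$, let $\mathrm{Syz}(\gamma)=\bigcap_i V(q_i)\subset\mathbb{P}^{g-1}$, and define the second syzygy scheme of $C$ as the scheme-theoretic intersection $$\mathrm{Syz}_2(C)=\bigcap_{0\ne\gamma\in K_{2,1}(C)}\mathrm{Syz}(\gamma).$$ If $a>0$ and $b>0$, then $\mathrm{Syz}_2(C)=C$ as closed subschemes of $\mathbb{P}^{g-1}$. -/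

import Mathlib

open scoped TensorProduct

noncomputable section

namespace ScrollCurve

/-! ### Closed subschemes of projective space

A closed subscheme of `ℙ^{g-1}` over `ℂ` is represented by its saturated homogeneous ideal in
`ℂ[Z_1, …, Z_g] = MvPolynomial (Fin g) ℂ`. -/

/-- The saturation `⋃ₙ (I : (Z_1, …, Z_g)ⁿ)`. Two homogeneous ideals define the same closed
subscheme of `ℙ^{g-1}` exactly when their saturations agree. -/
def saturation {g : ℕ} (I : Ideal (MvPolynomial (Fin g) ℂ)) : Ideal (MvPolynomial (Fin g) ℂ) where
  carrier := {f | ∃ n : ℕ, ∀ h ∈ (Ideal.span (Set.range MvPolynomial.X) :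
    Ideal (MvPolynomial (Fin g) ℂ)) ^ n, h * f ∈ I}
  zero_mem' := ⟨0, fun h _ => by simp⟩
  add_mem' := by
    rintro f₁ f₂ ⟨n₁, h₁⟩ ⟨n₂, h₂⟩
    refine ⟨max n₁ n₂, fun h hh => ?_⟩
    rw [mul_add]
    exact I.add_mem (h₁ h (Ideal.pow_le_pow_right (le_max_left _ _) hh))
      (h₂ h (Ideal.pow_le_pow_right (le_max_right _ _) hh))
  smul_mem' := by
    rintro c f ⟨n, hf⟩
    refine ⟨n, fun h hh => ?_⟩
    have e : h * (c • f) = c * (h * f) := by rw [smul_eq_mul]; ring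
    rw [e]
    exact I.mul_mem_left c (hf h hh)

/-- The coordinate ring `ℂ[Z_1, …, Z_g] / (I, Z_i - 1)` of the affine chart `{Z_i ≠ 0}` of the
subscheme of `ℙ^{g-1}` defined by the homogeneous ideal `I`. -/
abbrev chartRing {g : ℕ} (I : Ideal (MvPolynomial (Fin g) ℂ)) (i : Fin g) : Type :=
  MvPolynomial (Fin g) ℂ ⧸ (I ⊔ Ideal.span {MvPolynomial.X i - 1})

/-- The subscheme of `ℙ^{g-1}` defined by the homogeneous ideal `I` is a nonsingular curve:
it is smooth over `ℂ`, and its local ring at every closed point has dimension one. -/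
def IsNonsingularCurve {g : ℕ} (I : Ideal (MvPolynomial (Fin g) ℂ)) : Prop :=
  ∀ i : Fin g, Algebra.Smooth ℂ (chartRing I i) ∧
    ∀ P : Ideal (chartRing I i), P.IsMaximal → P.height = 1

/-! ### The second syzygy scheme -/

/-- The space `V` of linear forms on `ℙ^{g-1}`. -/
abbrev linearForms (g : ℕ) : Submodule ℂ (MvPolynomial (Fin g) ℂ) :=
  MvPolynomial.homogeneousSubmodule (Fin g) ℂ 1

/-- The space `I_2` of quadrics in the ideal `I`. -/
abbrev quadrics {g : ℕ} (I : Ideal (MvPolynomial (Fin g) ℂ)) :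
    Submodule ℂ (MvPolynomial (Fin g) ℂ) :=
  I.restrictScalars ℂ ⊓ MvPolynomial.homogeneousSubmodule (Fin g) ℂ 2

/-- The multiplication map `V ⊗ I_2 → ℂ[Z_1, …, Z_g]`, `ℓ ⊗ Q ↦ ℓ Q`. -/
def multiplication {g : ℕ} (I : Ideal (MvPolynomial (Fin g) ℂ)) :
    linearForms g ⊗[ℂ] quadrics I →ₗ[ℂ] MvPolynomial (Fin g) ℂ :=
  LinearMap.mul' ℂ (MvPolynomial (Fin g) ℂ) ∘ₗ
    TensorProduct.map (linearForms g).subtype (quadrics I).subtype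

/-- The space of linear syzygies among the quadrics of `I`,
`K_{2,1} = ker (V ⊗ I_2 → I_3)`. -/
def linearSyzygies {g : ℕ} (I : Ideal (MvPolynomial (Fin g) ℂ)) :
    Submodule ℂ (linearForms g ⊗[ℂ] quadrics I) :=
  LinearMap.ker (multiplication I)

/-- The quadrics involved in `γ ∈ V ⊗ I_2`: the image of the map `V* → I_2` given by contraction
with `γ`. If `γ = ∑ ℓ_i ⊗ Q_i` with linearly independent `ℓ_i`, this is the span of the `Q_i`. -/
def involvedQuadrics {g : ℕ} {I : Ideal (MvPolynomial (Fin g) ℂ)}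
    (γ : linearForms g ⊗[ℂ] quadrics I) : Set (MvPolynomial (Fin g) ℂ) :=
  {q | ∃ φ : Module.Dual ℂ (linearForms g),
    q = (TensorProduct.lid ℂ (quadrics I) (LinearMap.rTensor (quadrics I) φ γ) : quadrics I)}

/-- The ideal generated by the quadrics involved in `γ`; it defines the scheme `Syz(γ)`. -/
def syzygyIdeal {g : ℕ} {I : Ideal (MvPolynomial (Fin g) ℂ)}
    (γ : linearForms g ⊗[ℂ] quadrics I) : Ideal (MvPolynomial (Fin g) ℂ) :=
  Ideal.span (involvedQuadrics γ)

/-- The saturated homogeneous ideal of the second syzygy scheme, the scheme-theoretic intersection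
of the schemes `Syz(γ)` over all nonzero linear syzygies `γ`, of the subscheme with ideal `I`. -/
def syz₂ {g : ℕ} (I : Ideal (MvPolynomial (Fin g) ℂ)) : Ideal (MvPolynomial (Fin g) ℂ) :=
  saturation (⨆ γ ∈ {γ | γ ∈ linearSyzygies I ∧ γ ≠ 0}, syzygyIdeal γ)

/-! ### Rational normal scrolls of dimension three -/

/-- The total coordinate ring `ℂ[s, t, y_1, y_2, y_3]` of
`ℙ(𝒪(k_1) ⊕ 𝒪(k_2) ⊕ 𝒪(k_3))` over `ℙ¹`; here `s, t` are the variables `Sum.inl _`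
and the `y_i` are the variables `Sum.inr _`. -/
abbrev CoxRing : Type := MvPolynomial (Fin 2 ⊕ Fin 3) ℂ

/-- The bidegrees, in the basis `H, F` of the Picard group: `s` and `t` are sections of `𝒪(F)`,
and `y_i` is a section of `𝒪(H - k_i F)`. -/
def bidegree (k : Fin 3 → ℕ) : Fin 2 ⊕ Fin 3 → ℤ × ℤ :=
  Sum.elim (fun _ => (0, 1)) (fun i => (1, -(k i : ℤ)))

/-- `H⁰(𝒪(dH + eF))`, the space of bihomogeneous polynomials of bidegree `(d, e)`. For `d = 2` it
consists of the `∑ A_{ij}(s, t) y_i y_j` with `A_{ij}` binary forms of degree `k_i + k_j + e`, so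
it is `H⁰(ℙ¹, S²ℰ(e))`. -/
def sections (k : Fin 3 → ℕ) (d e : ℤ) : Submodule ℂ CoxRing :=
  MvPolynomial.weightedHomogeneousSubmodule ℂ (bidegree k) (d, e)

/-- Restriction of polynomials from `ℙ^{g-1}` to the scroll, where the scroll is mapped to
`ℙ^{g-1}` by the complete linear system `|H|` by means of the basis `x` of `H⁰(𝒪(H))`.
The kernel is the homogeneous ideal of the scroll `X ⊂ ℙ^{g-1}`. -/
def restriction {g : ℕ} {k : Fin 3 → ℕ} (x : Module.Basis (Fin g) ℂ (sections k 1 0)) :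
    MvPolynomial (Fin g) ℂ →ₐ[ℂ] CoxRing :=
  MvPolynomial.aeval fun j => (x j : CoxRing)

/-- The homogeneous ideal in `ℙ^{g-1}` of the divisor of zeros on the scroll of the section `Q`:
a form vanishes on it when its restriction to the scroll is divisible by `Q`. -/
def divisorIdeal {g : ℕ} {k : Fin 3 → ℕ} (x : Module.Basis (Fin g) ℂ (sections k 1 0))
    (Q : CoxRing) : Ideal (MvPolynomial (Fin g) ℂ) :=
  (Ideal.span {Q}).comap (restriction x)

/-- The saturated homogeneous ideal in `ℙ^{g-1}` of the scheme-theoretic intersection of the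
divisors of zeros on the scroll of the sections `Q₁` and `Q₂`. -/
def intersectionIdeal {g : ℕ} {k : Fin 3 → ℕ} (x : Module.Basis (Fin g) ℂ (sections k 1 0))
    (Q₁ Q₂ : CoxRing) : Ideal (MvPolynomial (Fin g) ℂ) :=
  saturation (divisorIdeal x Q₁ ⊔ divisorIdeal x Q₂)

end ScrollCurve

end

noncomputable section

namespace ScrollCurve

open MvPolynomial

/-! ### Saturation -/

/-! Write I for the saturated ideal of C and J for the ideal generated by all quadrics involved in
nonzero linear syzygies. Since J ≤ I and I is saturated, one inclusion is formal. For the other it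
suffices that J contains the ideals of both divisors Q₁ and Q₂ on the scroll, because I is the
saturation of their sum. The two divisors are treated separately (`divisorIdeal_le_syzygySum`).

The ideal of the scroll is generated by the 2×2 minors of a 2×(g-3) matrix of linear forms
(`ker_restriction`). As g ≥ 6, any two columns can be completed by a third, and the resulting
Eagon–Northcott syzygy involves the minor of the first two (`scrollMinor_mem_syzygySum`).

Modulo the scroll, the ideal of a divisor Q in |2H - aF| is generated by quadrics restricting to s^c
t^e Q with c + e = a. If a > 0, each of them has a neighbour with restriction in the ratio s : t.
Cross-multiplying the pair by two linear forms in that ratio gives a cubic in the ideal of the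
scroll, hence a linear syzygy involving both quadrics up to minors (`mem_syzygySum_of_ratio`). For a
= 0 there is a single such quadric and no neighbour. -/

lemma le_saturation {g : ℕ} (I : Ideal (MvPolynomial (Fin g) ℂ)) : I ≤ saturation I :=
  fun _ hf => ⟨0, fun h _ => I.mul_mem_left h hf⟩

lemma saturation_mono {g : ℕ} {I J : Ideal (MvPolynomial (Fin g) ℂ)} (h : I ≤ J) :
    saturation I ≤ saturation J := by
  rintro f ⟨n, hf⟩
  exact ⟨n, fun p hp => h (hf p hp)⟩

lemma saturation_saturation {g : ℕ} (I : Ideal (MvPolynomial (Fin g) ℂ)) :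
    saturation (saturation I) = saturation I := by
  refine le_antisymm ?_ (le_saturation _)
  rintro f ⟨n, hf⟩
  set m : Ideal (MvPolynomial (Fin g) ℂ) := Ideal.span (Set.range X) with hm
  obtain ⟨s, hs⟩ : (m ^ n).FG := IsNoetherian.noetherian _
  have key : ∀ p ∈ s, ∃ N : ℕ, ∀ h ∈ m ^ N, h * (p * f) ∈ I := fun p hp =>
    hf p (hs ▸ Ideal.subset_span hp)
  choose! N hN using key
  -- The finitely many generators of m ^ n have a common exponent `s.sup N`; the product with m ^ n
  -- then carries f into I.
  refine ⟨s.sup N + n, fun h hh => ?_⟩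
  have hle : m ^ s.sup N * m ^ n ≤
      Submodule.comap (LinearMap.mulRight (MvPolynomial (Fin g) ℂ) f) I := by
    rw [← hs, Ideal.mul_le]
    intro r hr q hq
    induction hq using Submodule.span_induction with
    | mem p hp =>
      have := hN p hp r (Ideal.pow_le_pow_right (Finset.le_sup hp) hr)
      simpa [mul_assoc] using this
    | zero => simp
    | add p q _ _ h1 h2 => rw [mul_add]; exact add_mem h1 h2
    | smul c p _ h1 =>
      rw [smul_eq_mul, mul_left_comm]
      exact Submodule.smul_mem _ c h1
  rw [pow_add] at hh
  exact hle hh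

/-! ### Straightening -/

section Straightening

variable {A : Type*} [CommRing A] (k : Fin 3 → ℕ) (z : Fin 3 → ℕ → A)

/-- The indices `(i, j)` of the monomial basis `s ^ j * t ^ (k i - j) * y_i` of `H⁰(𝒪(H))`. -/
def ValidIndices (m : Multiset (Fin 3 × ℕ)) : Prop := ∀ p ∈ m, p.2 ≤ k p.1

variable {k z}

lemma validIndices_cons {p : Fin 3 × ℕ} {m : Multiset (Fin 3 × ℕ)} :
    ValidIndices k (p ::ₘ m) ↔ p.2 ≤ k p.1 ∧ ValidIndices k m := by
  simp [ValidIndices]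

lemma ValidIndices.sum_snd_le {m : Multiset (Fin 3 × ℕ)} (hm : ValidIndices k m) :
    (m.map Prod.snd).sum ≤ (m.map fun p => k p.1).sum :=
  Multiset.sum_map_le_sum_map _ _ hm

/-- One factor s is taken from another entry of the product and given to the distinguished one, by a
single minor relation. A positive total in `r` provides an entry to take it from. -/
lemma exists_straighten_step_up
    (hz : ∀ i i' j j', j < k i → j' < k i' → z i j * z i' (j' + 1) = z i (j + 1) * z i' j')
    {i : Fin 3} {j : ℕ} (hj : j < k i) {r : Multiset (Fin 3 × ℕ)} (hr : ValidIndices k r)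
    (hpos : 0 < (r.map Prod.snd).sum) :
    ∃ r', ValidIndices k r' ∧ r'.map Prod.fst = r.map Prod.fst ∧
      (r.map Prod.snd).sum = (r'.map Prod.snd).sum + 1 ∧
      z i j * (r.map fun p => z p.1 p.2).prod = z i (j + 1) * (r'.map fun p => z p.1 p.2).prod := by
  obtain ⟨⟨i', j'⟩, hp, hne⟩ : ∃ p ∈ r, p.2 ≠ 0 := by
    by_contra! h
    have : (r.map Prod.snd).sum = 0 := by
      rw [Multiset.sum_eq_zero_iff]
      simpa using fun a b hab => h (b, a) hab
    omega
  obtain ⟨q, rfl⟩ := Multiset.exists_cons_of_mem hp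
  obtain ⟨j', rfl⟩ := Nat.exists_eq_succ_of_ne_zero hne
  rw [validIndices_cons] at hr
  dsimp only at hr
  refine ⟨(i', j') ::ₘ q, validIndices_cons.2 ⟨by dsimp only; omega, hr.2⟩, by simp, by simp; ring, ?_⟩
  simp only [Multiset.map_cons, Multiset.prod_cons]
  rw [← mul_assoc, ← mul_assoc, ← hz i i' j j' hj (by omega)]

lemma exists_straighten_step_down
    (hz : ∀ i i' j j', j < k i → j' < k i' → z i j * z i' (j' + 1) = z i (j + 1) * z i' j')
    {i : Fin 3} {j : ℕ} (hj : j < k i) {r : Multiset (Fin 3 × ℕ)} (hr : ValidIndices k r)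
    (hlt : (r.map Prod.snd).sum < (r.map fun p => k p.1).sum) :
    ∃ r', ValidIndices k r' ∧ r'.map Prod.fst = r.map Prod.fst ∧
      (r.map Prod.snd).sum + 1 = (r'.map Prod.snd).sum ∧
      z i (j + 1) * (r.map fun p => z p.1 p.2).prod = z i j * (r'.map fun p => z p.1 p.2).prod := by
  obtain ⟨⟨i', j'⟩, hp, hlt'⟩ : ∃ p ∈ r, p.2 < k p.1 := by
    by_contra! h
    exact absurd (Multiset.sum_map_le_sum_map _ _ h) (not_le.2 hlt)
  obtain ⟨q, rfl⟩ := Multiset.exists_cons_of_mem hp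
  rw [validIndices_cons] at hr
  dsimp only at hr hlt'
  refine ⟨(i', j' + 1) ::ₘ q, validIndices_cons.2 ⟨hlt', hr.2⟩, by simp, by simp; ring, ?_⟩
  simp only [Multiset.map_cons, Multiset.prod_cons]
  rw [← mul_assoc, ← mul_assoc, hz i i' j j' hj hlt']

lemma sum_degrees_eq {r r' : Multiset (Fin 3 × ℕ)} (h : r'.map Prod.fst = r.map Prod.fst) :
    (r'.map fun p => k p.1).sum = (r.map fun p => k p.1).sum := by
  have := congrArg (fun m => (Multiset.map k m).sum) h
  simpa [Multiset.map_map, Function.comp_def] using this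

/-- Unit exchanges are repeated until the distinguished index is j. The number n bounds the distance
from j₀ to j; the last two inequalities say that the rest of the product has enough units to give,
or enough room to absorb them. -/
lemma exists_straighten
    (hz : ∀ i i' j j', j < k i → j' < k i' → z i j * z i' (j' + 1) = z i (j + 1) * z i' j')
    {i : Fin 3} {j : ℕ} (hj : j ≤ k i) (n : ℕ) : ∀ {j₀ : ℕ} (_ : j₀ ≤ k i)
    (_ : j₀ ≤ j + n) (_ : j ≤ j₀ + n)
    {r : Multiset (Fin 3 × ℕ)} (_ : ValidIndices k r)
    (_ : j ≤ j₀ + (r.map Prod.snd).sum)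
    (_ : j₀ + (r.map Prod.snd).sum ≤ j + (r.map fun p => k p.1).sum),
    ∃ r', ValidIndices k r' ∧ r'.map Prod.fst = r.map Prod.fst ∧
      j₀ + (r.map Prod.snd).sum = j + (r'.map Prod.snd).sum ∧
      z i j₀ * (r.map fun p => z p.1 p.2).prod = z i j * (r'.map fun p => z p.1 p.2).prod := by
  induction n with
  | zero =>
    intro j₀ _ h1 h2 r hr _ _
    obtain rfl : j₀ = j := by omega
    exact ⟨r, hr, rfl, rfl, rfl⟩
  | succ n ih =>
    intro j₀ h0 h1 h2 r hr h3 h4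
    rcases lt_trichotomy j₀ j with h | rfl | h
    · obtain ⟨r₁, v₁, f₁, s₁, p₁⟩ := exists_straighten_step_up (z := z) hz
        (by omega : j₀ < k i) hr (by omega)
      have e := sum_degrees_eq (k := k) f₁
      obtain ⟨r₂, v₂, f₂, s₂, p₂⟩ := ih (j₀ := j₀ + 1) (by omega) (by omega) (by omega) v₁
        (by omega) (by omega)
      exact ⟨r₂, v₂, f₂.trans f₁, by omega, p₁.trans p₂⟩
    · exact ⟨r, hr, rfl, rfl, rfl⟩
    · obtain ⟨j₁, rfl⟩ : ∃ j₁, j₀ = j₁ + 1 := ⟨j₀ - 1, by omega⟩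
      obtain ⟨r₁, v₁, f₁, s₁, p₁⟩ := exists_straighten_step_down (z := z) hz
        (by omega : j₁ < k i) hr (by omega)
      have e := sum_degrees_eq (k := k) f₁
      obtain ⟨r₂, v₂, f₂, s₂, p₂⟩ := ih (j₀ := j₁) (by omega) (by omega) (by omega) v₁
        (by omega) (by omega)
      exact ⟨r₂, v₂, f₂.trans f₁, by omega, p₁.trans p₂⟩

/-- The minor relations only redistribute the powers of s among the entries, so a product depends
only on which y_i occur and on the total power of s. Induction on the target: one entry of the
source is brought to the target's first entry, then both are cancelled. -/
theorem prod_eq_of_minors_eq_zero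
    (hz : ∀ i i' j j', j < k i → j' < k i' → z i j * z i' (j' + 1) = z i (j + 1) * z i' j')
    (m' : Multiset (Fin 3 × ℕ)) : ∀ m : Multiset (Fin 3 × ℕ),
    ValidIndices k m → ValidIndices k m' → m.map Prod.fst = m'.map Prod.fst →
    (m.map Prod.snd).sum = (m'.map Prod.snd).sum →
    (m.map fun p => z p.1 p.2).prod = (m'.map fun p => z p.1 p.2).prod := by
  induction m' using Multiset.induction with
  | empty =>
    intro m _ _ h _
    have : m = 0 := by simpa using h
    simp [this]
  | cons p r' ih =>
    intro m hm hm' hf hs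
    obtain ⟨i, j⟩ := p
    have hi : i ∈ m.map Prod.fst := by rw [hf]; simp
    obtain ⟨⟨i₀, j₀⟩, hp, rfl⟩ := Multiset.mem_map.1 hi
    obtain ⟨r, rfl⟩ := Multiset.exists_cons_of_mem hp
    rw [validIndices_cons] at hm hm'
    simp only [Multiset.map_cons, Multiset.sum_cons, Multiset.prod_cons,
      Multiset.cons_inj_right] at *
    have e := sum_degrees_eq (k := k) hf
    have := hm'.2.sum_snd_le
    -- The remaining totals suffice because the target's remaining entries are themselves valid and
    -- have the same first indices.
    obtain ⟨r₁, v₁, f₁, s₁, p₁⟩ := exists_straighten (z := z) hz hm'.1 (j₀ + j) hm.1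
      (by omega) (by omega) hm.2 (by omega) (by omega)
    rw [p₁, ih r₁ v₁ hm'.2 (f₁.trans hf) (by omega)]

end Straightening

section Scroll

/-! ### Monomials of the total coordinate ring -/

/-- This lets cofactors of a homogeneous element be replaced by their components of the right
degree. -/
lemma weightedHomogeneousComponent_add_mul {σ R M : Type*} [CommSemiring R]
    [AddCancelCommMonoid M] (w : σ → M) {q : MvPolynomial σ R} {n : M}
    (hq : IsWeightedHomogeneous w q n) (m : M) (p : MvPolynomial σ R) :
    weightedHomogeneousComponent w (m + n) (p * q) = weightedHomogeneousComponent w m p * q := by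
  classical
  let := weightedGradedAlgebra R w
  have := DirectSum.coe_decompose_mul_add_of_right_mem (weightedHomogeneousSubmodule R w)
    (i := m) (a := p) (b := q) ((mem_weightedHomogeneousSubmodule R w n q).2 hq)
  have e : ∀ (r : MvPolynomial σ R) (l : M),
      ((DirectSum.decompose (weightedHomogeneousSubmodule R w) r l : _) : MvPolynomial σ R) =
        weightedHomogeneousComponent w l r := fun r l => MvPolynomial.decompose'_apply R w r l
  rwa [e, e] at this

variable (k : Fin 3 → ℕ)

/-- The degree of a monomial of the total coordinate ring in the variables `y_i`. -/
def hDegree (d : Fin 2 ⊕ Fin 3 →₀ ℕ) : ℕ :=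
  d (Sum.inr 0) + d (Sum.inr 1) + d (Sum.inr 2)

/-- The degree of the coefficients of a monomial in the `y_i` for a section of a multiple of `H`. -/
def kDegree (d : Fin 2 ⊕ Fin 3 →₀ ℕ) : ℕ :=
  d (Sum.inr 0) * k 0 + d (Sum.inr 1) * k 1 + d (Sum.inr 2) * k 2

/-- The exponent of the monomial `s ^ j * t ^ (k i - j) * y_i`. -/
def sectionExponent (i : Fin 3) (j : ℕ) : Fin 2 ⊕ Fin 3 →₀ ℕ :=
  Finsupp.single (Sum.inl 0) j + Finsupp.single (Sum.inl 1) (k i - j) +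
    Finsupp.single (Sum.inr i) 1

@[simp] lemma sectionExponent_inl_zero (i : Fin 3) (j : ℕ) :
    sectionExponent k i j (Sum.inl 0) = j := by
  simp [sectionExponent]

@[simp] lemma sectionExponent_inl_one (i : Fin 3) (j : ℕ) :
    sectionExponent k i j (Sum.inl 1) = k i - j := by
  simp [sectionExponent]

@[simp] lemma sectionExponent_inr (i i' : Fin 3) (j : ℕ) :
    sectionExponent k i j (Sum.inr i') = if i = i' then 1 else 0 := by
  simp [sectionExponent, Finsupp.single_apply]

lemma sectionExponent_injective {i i' : Fin 3} {j j' : ℕ}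
    (h : sectionExponent k i j = sectionExponent k i' j') : i = i' ∧ j = j' := by
  have h0 := DFunLike.congr_fun h (Sum.inl 0)
  have h1 := DFunLike.congr_fun h (Sum.inr i')
  simp at h0 h1
  exact ⟨h1, h0⟩

lemma weight_bidegree (d : Fin 2 ⊕ Fin 3 →₀ ℕ) :
    Finsupp.weight (bidegree k) d =
      ((hDegree d : ℤ), (d (Sum.inl 0) : ℤ) + d (Sum.inl 1) - kDegree k d) := by
  rw [Finsupp.weight_apply, Finsupp.sum_fintype _ _ (by simp)]
  ext <;> simp [Fin.sum_univ_three, bidegree, hDegree, kDegree]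
  ring

lemma weight_fibre (d : Fin 2 ⊕ Fin 3 →₀ ℕ) :
    Finsupp.weight (fun v => (bidegree k v).2) d =
      (d (Sum.inl 0) : ℤ) + d (Sum.inl 1) - kDegree k d := by
  rw [Finsupp.weight_apply, Finsupp.sum_fintype _ _ (by simp)]
  simp [Fin.sum_univ_three, bidegree, kDegree]
  ring

lemma fibre_isWeightedHomogeneous {d e : ℤ} {p : CoxRing} (hp : p ∈ sections k d e) :
    IsWeightedHomogeneous (fun v => (bidegree k v).2) p e := by
  intro c hc
  have := hp hc
  rw [weight_bidegree, Prod.mk.injEq] at this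
  rw [weight_fibre, this.2]

lemma hDegree_sectionExponent (i : Fin 3) (j : ℕ) : hDegree (sectionExponent k i j) = 1 := by
  fin_cases i <;> simp [hDegree]

lemma kDegree_sectionExponent (i : Fin 3) (j : ℕ) : kDegree k (sectionExponent k i j) = k i := by
  fin_cases i <;> simp [kDegree]

lemma hDegree_add (d d' : Fin 2 ⊕ Fin 3 →₀ ℕ) : hDegree (d + d') = hDegree d + hDegree d' := by
  simp [hDegree]; ring

lemma kDegree_add (d d' : Fin 2 ⊕ Fin 3 →₀ ℕ) :
    kDegree k (d + d') = kDegree k d + kDegree k d' := by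
  simp [kDegree]; ring

lemma monomial_mem_sections (d : Fin 2 ⊕ Fin 3 →₀ ℕ) (c : ℂ) :
    (monomial d c : CoxRing) ∈
      sections k (hDegree d) ((d (Sum.inl 0) : ℤ) + d (Sum.inl 1) - kDegree k d) :=
  isWeightedHomogeneous_monomial _ _ _ (weight_bidegree k d)

lemma monomial_sectionExponent_mem {i : Fin 3} {j : ℕ} (hj : j ≤ k i) :
    (monomial (sectionExponent k i j) 1 : CoxRing) ∈ sections k 1 0 := by
  have := monomial_mem_sections k (sectionExponent k i j) 1
  rw [hDegree_sectionExponent, kDegree_sectionExponent] at this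
  convert this using 1
  simp [hj]

lemma exists_eq_sectionExponent_add {d : Fin 2 ⊕ Fin 3 →₀ ℕ} (hd : 0 < hDegree d)
    (hk : d (Sum.inl 0) + d (Sum.inl 1) = kDegree k d) :
    ∃ i j d', j ≤ k i ∧ d = sectionExponent k i j + d' ∧ hDegree d = hDegree d' + 1 ∧
      d' (Sum.inl 0) + d' (Sum.inl 1) = kDegree k d' := by
  obtain ⟨i, hi⟩ : ∃ i, 0 < d (Sum.inr i) := by
    by_contra! h
    simp [hDegree, Nat.le_zero.1 (h _)] at hd
  have hki : k i ≤ kDegree k d := by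
    have : k i ≤ d (Sum.inr i) * k i := Nat.le_mul_of_pos_left _ hi
    unfold kDegree
    fin_cases i <;> dsimp at * <;> omega
  -- Use as many factors s as possible; enough factors t remain, since k_i is at most the total
  -- exponent of s and t.
  obtain ⟨j, hj⟩ : ∃ j, j = min (d (Sum.inl 0)) (k i) := ⟨_, rfl⟩
  have hle : sectionExponent k i j ≤ d := by
    intro v
    rcases v with v | v
    · fin_cases v <;> simp <;> omega
    · rw [sectionExponent_inr]
      split_ifs with h
      · exact h ▸ hi
      · exact Nat.zero_le _
  obtain ⟨d', rfl⟩ := exists_add_of_le hle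
  refine ⟨i, j, d', by omega, rfl, ?_, ?_⟩
  · rw [hDegree_add, hDegree_sectionExponent]; ring
  · rw [kDegree_add, kDegree_sectionExponent] at hk
    simp only [Finsupp.add_apply, sectionExponent_inl_zero, sectionExponent_inl_one] at hk hj
    omega

/-! ### Lifting sections to forms on projective space -/

variable {g : ℕ} {k} (x : Module.Basis (Fin g) ℂ (sections k 1 0))

lemma restriction_X (n : Fin g) : restriction x (X n) = (x n : CoxRing) := by
  simp [restriction]

/-- The lift is extended to the whole ring with arbitrary values off H⁰(𝒪(H)), so that it applies to
a polynomial without a proof of membership. -/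
lemma exists_linearLift : ∃ L : CoxRing →ₗ[ℂ] MvPolynomial (Fin g) ℂ,
    (∀ n, L (x n) = X n) ∧
      ∀ u ∈ sections k 1 0, (L u).IsHomogeneous 1 ∧ restriction x (L u) = u := by
  obtain ⟨L, hL⟩ := LinearMap.exists_extend
    (x.constr ℂ (X : Fin g → MvPolynomial (Fin g) ℂ))
  have hX : ∀ n, L (x n) = X n := fun n => by
    have := LinearMap.congr_fun hL (x n)
    simpa using this
  refine ⟨L, hX, fun u hu => ?_⟩
  have hu' : u = ∑ n, x.repr ⟨u, hu⟩ n • (x n : CoxRing) := by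
    have := congrArg (sections k 1 0).subtype (x.sum_repr ⟨u, hu⟩).symm
    simpa only [map_sum, map_smul, Submodule.subtype_apply] using this
  have hLu : L u = ∑ n, x.repr ⟨u, hu⟩ n • X n := by
    conv_lhs => rw [hu']
    simp [hX]
  refine ⟨?_, ?_⟩
  · rw [hLu]
    exact Submodule.sum_mem (homogeneousSubmodule (Fin g) ℂ 1) fun n _ =>
      Submodule.smul_mem _ _ (isHomogeneous_X ℂ n)
  · rw [hLu, map_sum]
    conv_rhs => rw [hu']
    simp [restriction]

/-- A linear section of the restriction of linear forms to the scroll. -/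
def linearLift : CoxRing →ₗ[ℂ] MvPolynomial (Fin g) ℂ := (exists_linearLift x).choose

lemma linearLift_basis (n : Fin g) : linearLift x (x n) = X n :=
  (exists_linearLift x).choose_spec.1 n

lemma linearLift_isHomogeneous {u : CoxRing} (hu : u ∈ sections k 1 0) :
    (linearLift x u).IsHomogeneous 1 :=
  ((exists_linearLift x).choose_spec.2 u hu).1

lemma restriction_linearLift {u : CoxRing} (hu : u ∈ sections k 1 0) :
    restriction x (linearLift x u) = u :=
  ((exists_linearLift x).choose_spec.2 u hu).2

/-- The linear form that restricts to the section `s ^ j * t ^ (k i - j) * y_i`. -/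
def scrollForm (i : Fin 3) (j : ℕ) : MvPolynomial (Fin g) ℂ :=
  linearLift x (monomial (sectionExponent k i j) 1)

lemma scrollForm_isHomogeneous {i : Fin 3} {j : ℕ} (hj : j ≤ k i) :
    (scrollForm x i j).IsHomogeneous 1 :=
  linearLift_isHomogeneous x (monomial_sectionExponent_mem k hj)

lemma restriction_scrollForm {i : Fin 3} {j : ℕ} (hj : j ≤ k i) :
    restriction x (scrollForm x i j) = monomial (sectionExponent k i j) 1 :=
  restriction_linearLift x (monomial_sectionExponent_mem k hj)

lemma exists_restriction_eq_monomial (n : ℕ) : ∀ {d : Fin 2 ⊕ Fin 3 →₀ ℕ} (_ : hDegree d = n)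
    (_ : d (Sum.inl 0) + d (Sum.inl 1) = kDegree k d),
    ∃ f : MvPolynomial (Fin g) ℂ, f.IsHomogeneous n ∧ restriction x f = monomial d 1 := by
  induction n with
  | zero =>
    intro d hn hd
    refine ⟨1, isHomogeneous_one _ _, ?_⟩
    have h0 : d (Sum.inr 0) = 0 ∧ d (Sum.inr 1) = 0 ∧ d (Sum.inr 2) = 0 := by
      unfold hDegree at hn; omega
    have h1 : d (Sum.inl 0) = 0 ∧ d (Sum.inl 1) = 0 := by
      simp [kDegree, h0] at hd; exact hd
    have : d = 0 := by
      ext v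
      rcases v with v | v <;> fin_cases v <;> simp [h0, h1]
    rw [map_one, this]; rfl
  | succ n ih =>
    intro d hn hd
    obtain ⟨i, j, d', hj, rfl, h1, h2⟩ := exists_eq_sectionExponent_add k (by omega) hd
    obtain ⟨f, hf, hfr⟩ := ih (by omega) h2
    refine ⟨scrollForm x i j * f, ?_, ?_⟩
    · rw [add_comm]; exact (scrollForm_isHomogeneous x hj).mul hf
    · rw [map_mul, hfr, restriction_scrollForm x hj, monomial_mul, mul_one]

/-- Projective normality of the scroll: each monomial section of nH is a product of n monomial
sections of H. -/
lemma exists_restriction_eq {n : ℕ} {p : CoxRing} (hp : p ∈ sections k n 0) :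
    ∃ f : MvPolynomial (Fin g) ℂ, f.IsHomogeneous n ∧ restriction x f = p := by
  suffices h : p ∈ (homogeneousSubmodule (Fin g) ℂ n).map (restriction x).toLinearMap by
    obtain ⟨f, hf, e⟩ := h
    exact ⟨f, hf, e⟩
  rw [p.as_sum]
  refine Submodule.sum_mem _ fun d hd => ?_
  have hw := hp (mem_support_iff.1 hd)
  rw [weight_bidegree, Prod.mk.injEq] at hw
  obtain ⟨f, hf, e⟩ := exists_restriction_eq_monomial x n (d := d) (by omega) (by omega)
  refine ⟨coeff d p • f, Submodule.smul_mem _ _ hf, ?_⟩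
  simp [e, smul_monomial]

lemma X_mem_span_scrollForm (n : Fin g) : (X n : MvPolynomial (Fin g) ℂ) ∈
    Submodule.span ℂ {f | ∃ i j, j ≤ k i ∧ f = scrollForm x i j} := by
  rw [← linearLift_basis x, (x n : CoxRing).as_sum, map_sum]
  refine Submodule.sum_mem _ fun d hd => ?_
  have hw := (x n).2 (mem_support_iff.1 hd)
  rw [weight_bidegree, Prod.mk.injEq] at hw
  obtain ⟨i, j, d', hj, rfl, h1, h2⟩ := exists_eq_sectionExponent_add k (d := d)
    (by omega) (by omega)
  have h0 : d' (Sum.inr 0) = 0 ∧ d' (Sum.inr 1) = 0 ∧ d' (Sum.inr 2) = 0 := by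
    unfold hDegree at h1 hw; omega
  have h1 : d' (Sum.inl 0) = 0 ∧ d' (Sum.inl 1) = 0 := by
    simp [kDegree, h0] at h2; exact h2
  have : d' = 0 := by
    ext v
    rcases v with v | v <;> fin_cases v <;> simp [h0, h1]
  subst this
  rw [← mul_one (coeff _ _), ← smul_eq_mul, ← smul_monomial, map_smul, add_zero]
  exact Submodule.smul_mem _ _ (Submodule.subset_span ⟨i, j, hj, rfl⟩)

/-! ### The ideal of the scroll -/

/-- The minor with columns `s ^ j * t ^ (k i - 1 - j) * y_i` and
`s ^ j' * t ^ (k i' - 1 - j') * y_i'`. -/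
def scrollMinor (i i' : Fin 3) (j j' : ℕ) : MvPolynomial (Fin g) ℂ :=
  scrollForm x i (j + 1) * scrollForm x i' j' - scrollForm x i j * scrollForm x i' (j' + 1)

/-- The set of all minors of the scroll. -/
def scrollMinors : Set (MvPolynomial (Fin g) ℂ) :=
  {f | ∃ i i' j j', j < k i ∧ j' < k i' ∧ f = scrollMinor x i i' j j'}

lemma isHomogeneous_of_mem_scrollMinors {f : MvPolynomial (Fin g) ℂ}
    (hf : f ∈ scrollMinors x) : f.IsHomogeneous 2 := by
  obtain ⟨i, i', j, j', hj, hj', rfl⟩ := hf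
  exact ((scrollForm_isHomogeneous x hj).mul (scrollForm_isHomogeneous x hj'.le)).sub
    ((scrollForm_isHomogeneous x hj.le).mul (scrollForm_isHomogeneous x hj'))

lemma restriction_eq_zero_of_mem_scrollMinors {f : MvPolynomial (Fin g) ℂ}
    (hf : f ∈ scrollMinors x) : restriction x f = 0 := by
  obtain ⟨i, i', j, j', hj, hj', rfl⟩ := hf
  rw [scrollMinor, map_sub, map_mul, map_mul, restriction_scrollForm x hj,
    restriction_scrollForm x hj'.le, restriction_scrollForm x hj.le, restriction_scrollForm x hj',
    monomial_mul, monomial_mul, sub_eq_zero]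
  refine congrArg (fun d => monomial d _) (Finsupp.ext fun v => ?_)
  rcases v with v | v
  · fin_cases v <;> simp <;> omega
  · simp

/-- The product of the linear forms with the given indices. -/
def scrollProd (m : Multiset (Fin 3 × ℕ)) : MvPolynomial (Fin g) ℂ :=
  (m.map fun p => scrollForm x p.1 p.2).prod

variable (k) in
/-- The exponent of the restriction of a product of linear forms. -/
def prodExponent (m : Multiset (Fin 3 × ℕ)) : Fin 2 ⊕ Fin 3 →₀ ℕ :=
  (m.map fun p => sectionExponent k p.1 p.2).sum

lemma restriction_scrollProd {m : Multiset (Fin 3 × ℕ)} (hm : ValidIndices k m) :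
    restriction x (scrollProd x m) = monomial (prodExponent k m) 1 := by
  induction m using Multiset.induction with
  | empty => simp [scrollProd, prodExponent]
  | cons p m ih =>
    rw [validIndices_cons] at hm
    have := ih hm.2
    simp only [scrollProd, prodExponent, Multiset.map_cons, Multiset.prod_cons,
      Multiset.sum_cons, map_mul] at *
    rw [this, restriction_scrollForm x hm.1, monomial_mul, mul_one]

lemma prodExponent_inl_zero (m : Multiset (Fin 3 × ℕ)) :
    prodExponent k m (Sum.inl 0) = (m.map Prod.snd).sum := by
  induction m using Multiset.induction with
  | empty => simp [prodExponent]
  | cons p m ih => simp [prodExponent] at *; omega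

lemma prodExponent_inr (m : Multiset (Fin 3 × ℕ)) (i : Fin 3) :
    prodExponent k m (Sum.inr i) = (m.map Prod.fst).count i := by
  induction m using Multiset.induction with
  | empty => simp [prodExponent]
  | cons p m ih =>
    simp only [prodExponent, Multiset.map_cons, Multiset.sum_cons, Finsupp.add_apply,
      sectionExponent_inr, Multiset.count_cons] at *
    rw [ih, add_comm]
    simp [eq_comm]

lemma mk_scrollProd_eq {m m' : Multiset (Fin 3 × ℕ)} (hm : ValidIndices k m)
    (hm' : ValidIndices k m') (h : prodExponent k m = prodExponent k m') :
    Ideal.Quotient.mk (Ideal.span (scrollMinors x)) (scrollProd x m) =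
      Ideal.Quotient.mk (Ideal.span (scrollMinors x)) (scrollProd x m') := by
  have := prod_eq_of_minors_eq_zero (k := k)
    (z := fun i j => Ideal.Quotient.mk (Ideal.span (scrollMinors x)) (scrollForm x i j))
    (fun i i' j j' hj hj' => by
      rw [← map_mul, ← map_mul, eq_comm, Ideal.Quotient.eq]
      exact Ideal.subset_span ⟨i, i', j, j', hj, hj', rfl⟩) m' m hm hm'
    (Multiset.ext.2 fun i => by rw [← prodExponent_inr (k := k), h, prodExponent_inr])
    (by rw [← prodExponent_inl_zero (k := k), h, prodExponent_inl_zero])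
  simpa [scrollProd, map_multiset_prod, Multiset.map_map, Function.comp_def] using this

lemma span_scrollProd :
    Submodule.span ℂ {f | ∃ m, ValidIndices k m ∧ f = scrollProd x m} = ⊤ := by
  refine eq_top_iff.2 fun f _ => ?_
  induction f using MvPolynomial.induction_on with
  | C c =>
    rw [← mul_one (C c), ← smul_eq_C_mul]
    exact Submodule.smul_mem _ _ (Submodule.subset_span
      ⟨0, by simp [ValidIndices], by simp [scrollProd]⟩)
  | add p q hp hq => exact add_mem (hp trivial) (hq trivial)
  | mul_X p n hp =>
    have := Submodule.mul_mem_mul (hp trivial) (X_mem_span_scrollForm x n)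
    rw [Submodule.span_mul_span] at this
    refine Submodule.span_mono ?_ this
    rintro _ ⟨_, ⟨m, hm, rfl⟩, _, ⟨i, j, hj, rfl⟩, rfl⟩
    refine ⟨(i, j) ::ₘ m, validIndices_cons.2 ⟨hj, hm⟩, ?_⟩
    simp [scrollProd, mul_comm]

/-- A linear map τ back from the Cox ring to the quotient by the minors is built on monomials.
Straightening makes it independent of the chosen factorisation, and τ composed with restriction is
the quotient map, so an element of the kernel is zero modulo the minors. -/
theorem ker_restriction : RingHom.ker (restriction x) = Ideal.span (scrollMinors x) := by
  classical
  refine le_antisymm (fun f hf => ?_) (Ideal.span_le.2 fun f hf =>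
    restriction_eq_zero_of_mem_scrollMinors x hf)
  let J := Ideal.span (scrollMinors x)
  let τ : CoxRing →ₗ[ℂ] MvPolynomial (Fin g) ℂ ⧸ J :=
    -- The value 0 on other monomials is immaterial: products of scroll forms span the source and
    -- restrict to monomials of the first kind.
    (basisMonomials (Fin 2 ⊕ Fin 3) ℂ).constr ℂ fun d =>
      if h : ∃ m, ValidIndices k m ∧ prodExponent k m = d then
        Ideal.Quotient.mk J (scrollProd x h.choose) else 0
  have hτ : ∀ m, ValidIndices k m →
      τ (monomial (prodExponent k m) 1) = Ideal.Quotient.mk J (scrollProd x m) := by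
    intro m hm
    have h : ∃ m', ValidIndices k m' ∧ prodExponent k m' = prodExponent k m := ⟨m, hm, rfl⟩
    have := (basisMonomials (Fin 2 ⊕ Fin 3) ℂ).constr_basis ℂ (fun d =>
      if h : ∃ m, ValidIndices k m ∧ prodExponent k m = d then
        Ideal.Quotient.mk J (scrollProd x h.choose) else 0) (prodExponent k m)
    rw [coe_basisMonomials, dif_pos h] at this
    refine this.trans ?_
    exact mk_scrollProd_eq x h.choose_spec.1 hm h.choose_spec.2
  have key : τ ∘ₗ (restriction x).toLinearMap = (Ideal.Quotient.mkₐ ℂ J).toLinearMap := by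
    refine LinearMap.ext_on (span_scrollProd x) ?_
    rintro _ ⟨m, hm, rfl⟩
    simp [restriction_scrollProd x hm, hτ m hm]
  have := LinearMap.congr_fun key f
  rw [LinearMap.comp_apply, AlgHom.toLinearMap_apply, (RingHom.mem_ker).1 hf, map_zero] at this
  exact Ideal.Quotient.eq_zero_iff_mem.1 this.symm

end Scroll

/-! ### Quadrics involved in linear syzygies -/

section Syzygies

variable {g : ℕ} {I : Ideal (MvPolynomial (Fin g) ℂ)}

/-- Contraction of `V ⊗ I_2` with a linear functional on `V`. -/
def contraction (φ : Module.Dual ℂ (linearForms g)) :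
    linearForms g ⊗[ℂ] quadrics I →ₗ[ℂ] quadrics I :=
  (TensorProduct.lid ℂ (quadrics I)).toLinearMap ∘ₗ LinearMap.rTensor (quadrics I) φ

@[simp] lemma contraction_tmul (φ : Module.Dual ℂ (linearForms g)) (v : linearForms g)
    (q : quadrics I) : contraction φ (v ⊗ₜ[ℂ] q) = φ v • q := by
  simp [contraction]

@[simp] lemma multiplication_tmul (v : linearForms g) (q : quadrics I) :
    multiplication I (v ⊗ₜ[ℂ] q) = (v : MvPolynomial (Fin g) ℂ) * q := by
  simp [multiplication]

variable (I) in
/-- The ideal generated by the quadrics involved in the nonzero linear syzygies. -/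
def syzygySum : Ideal (MvPolynomial (Fin g) ℂ) :=
  ⨆ γ ∈ {γ | γ ∈ linearSyzygies I ∧ γ ≠ 0}, syzygyIdeal γ

lemma syzygySum_le : syzygySum I ≤ I := by
  refine iSup₂_le fun γ _ => Ideal.span_le.2 ?_
  rintro _ ⟨φ, rfl⟩
  exact (contraction φ γ).2.1

lemma contraction_mem_syzygySum {γ : linearForms g ⊗[ℂ] quadrics I}
    (hγ : multiplication I γ = 0) (φ : Module.Dual ℂ (linearForms g)) :
    (contraction φ γ : MvPolynomial (Fin g) ℂ) ∈ syzygySum I := by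
  by_cases h0 : γ = 0
  · simp [h0]
  · have hle : syzygyIdeal γ ≤ syzygySum I :=
      le_iSup₂_of_le (f := fun γ (_ : γ ∈ {γ | γ ∈ linearSyzygies I ∧ γ ≠ 0}) => syzygyIdeal γ)
        γ ⟨LinearMap.mem_ker.2 hγ, h0⟩ le_rfl
    exact hle (Ideal.subset_span ⟨φ, rfl⟩)

lemma exists_multiplication_eq {T : Set (MvPolynomial (Fin g) ℂ)}
    (hTI : T ⊆ (I : Set (MvPolynomial (Fin g) ℂ)))
    (hT : ∀ q ∈ T, q.IsHomogeneous 2) {f : MvPolynomial (Fin g) ℂ} (hf : f ∈ Ideal.span T)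
    (hf3 : f.IsHomogeneous 3) :
    ∃ δ : linearForms g ⊗[ℂ] quadrics I, multiplication I δ = f ∧
      ∀ φ, (contraction φ δ : MvPolynomial (Fin g) ℂ) ∈ Ideal.span T := by
  obtain ⟨n, c, q, rfl⟩ := Submodule.mem_span_set'.1 hf
  refine ⟨∑ i, (⟨homogeneousComponent 1 (c i), homogeneousComponent_mem _ _⟩ : linearForms g) ⊗ₜ
    (⟨q i, hTI (q i).2, hT _ (q i).2⟩ : quadrics I), ?_, fun φ => ?_⟩
  -- In degree 3 only the linear parts of the coefficients contribute, as the generators are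
  -- quadrics.
  · rw [← hf3.weightedHomogeneousComponent_same]
    simp only [map_sum, multiplication_tmul, smul_eq_mul]
    exact Finset.sum_congr rfl fun i _ =>
      (weightedHomogeneousComponent_add_mul _ (hT _ (q i).2) 1 (c i)).symm
  · simp only [map_sum, contraction_tmul]
    rw [AddSubmonoidClass.coe_finsetSum]
    refine Ideal.sum_mem _ fun i _ => ?_
    rw [Submodule.coe_smul]
    exact Submodule.smul_of_tower_mem _ _ (Ideal.subset_span (q i).2)

end Syzygies

/-! ### Quadrics on the scroll and on its divisors -/

variable {g : ℕ} {k : Fin 3 → ℕ} (x : Module.Basis (Fin g) ℂ (sections k 1 0))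
  {I : Ideal (MvPolynomial (Fin g) ℂ)}

/-- The functional on linear forms that reads off a coefficient of the restriction. -/
def coeffDual (d : Fin 2 ⊕ Fin 3 →₀ ℕ) : Module.Dual ℂ (linearForms g) :=
  lcoeff ℂ d ∘ₗ (restriction x).toLinearMap ∘ₗ (linearForms g).subtype

/-- The linear forms `scrollForm` as elements of `V`. -/
def scrollVector {i : Fin 3} {j : ℕ} (hj : j ≤ k i) : linearForms g :=
  ⟨scrollForm x i j, scrollForm_isHomogeneous x hj⟩

lemma coeffDual_scrollVector_self {i : Fin 3} {j : ℕ} (hj : j ≤ k i) :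
    coeffDual x (sectionExponent k i j) (scrollVector x hj) = 1 := by
  simp [coeffDual, scrollVector, restriction_scrollForm x hj]

lemma coeffDual_scrollVector_of_ne {i i' : Fin 3} {j j' : ℕ} (hj : j ≤ k i)
    (h : ¬ (i = i' ∧ j = j')) :
    coeffDual x (sectionExponent k i' j') (scrollVector x hj) = 0 := by
  simp only [coeffDual, scrollVector, LinearMap.comp_apply, Submodule.subtype_apply,
    AlgHom.toLinearMap_apply, restriction_scrollForm x hj, lcoeff_apply, coeff_monomial]
  exact if_neg fun e => h (sectionExponent_injective k e)

/-! ### Eagon–Northcott syzygies among the minors -/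

lemma exists_third_column (hk3 : 3 ≤ k 0 + k 1 + k 2) (p q : Σ _ : Fin 3, ℕ) :
    ∃ i j, j < k i ∧ (⟨i, j⟩ : Σ _ : Fin 3, ℕ) ≠ p ∧ (⟨i, j⟩ : Σ _ : Fin 3, ℕ) ≠ q := by
  obtain ⟨⟨i, j⟩, h, h'⟩ := Finset.exists_mem_notMem_of_card_lt_card
    (s := {p, q}) (t := (Finset.univ : Finset (Fin 3)).sigma fun i => Finset.range (k i)) (by
      rw [Finset.card_sigma]
      simp only [Finset.card_range, Fin.sum_univ_three]
      exact lt_of_le_of_lt Finset.card_le_two (by omega))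
  simp only [Finset.mem_sigma, Finset.mem_univ, true_and, Finset.mem_range,
    Finset.mem_insert, Finset.mem_singleton, not_or] at h h'
  exact ⟨i, j, h, h'⟩

lemma scrollMinor_mem_syzygySum (hk3 : 3 ≤ k 0 + k 1 + k 2)
    (hI : Ideal.span (scrollMinors x) ≤ I) {i₁ i₂ : Fin 3} {j₁ j₂ : ℕ}
    (h₁ : j₁ < k i₁) (h₂ : j₂ < k i₂) : scrollMinor x i₁ i₂ j₁ j₂ ∈ syzygySum I := by
  obtain ⟨i₃, j₃, h₃, hne₁, hne₂⟩ := exists_third_column hk3 ⟨i₁, j₁⟩ ⟨i₂, j₂⟩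
  have hm : ∀ {i i' : Fin 3} {j j' : ℕ}, j < k i → j' < k i' →
      scrollMinor x i i' j j' ∈ quadrics I := fun {i i' j j'} hj hj' =>
    have h : scrollMinor x i i' j j' ∈ scrollMinors x := ⟨i, i', j, j', hj, hj', rfl⟩
    ⟨hI (Ideal.subset_span h), isHomogeneous_of_mem_scrollMinors x h⟩
  -- Laplace expansion of the 3×3 determinant obtained by repeating one row of three columns.
  have hγ : multiplication I
      (scrollVector x (Nat.succ_le_of_lt h₁) ⊗ₜ[ℂ] (⟨_, hm h₂ h₃⟩ : quadrics I) -
        scrollVector x (Nat.succ_le_of_lt h₂) ⊗ₜ[ℂ] (⟨_, hm h₁ h₃⟩ : quadrics I) +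
        scrollVector x (Nat.succ_le_of_lt h₃) ⊗ₜ[ℂ] (⟨_, hm h₁ h₂⟩ : quadrics I)) = 0 := by
    simp only [map_add, map_sub, multiplication_tmul, scrollVector, scrollMinor]
    ring
  -- The functional is 1 on the linear form of the third column and 0 on the other two, hence
  -- isolates the minor of the first two columns.
  have := contraction_mem_syzygySum hγ (coeffDual x (sectionExponent k i₃ (j₃ + 1)))
  rw [map_add, map_sub, contraction_tmul, contraction_tmul, contraction_tmul,
    coeffDual_scrollVector_self, coeffDual_scrollVector_of_ne, coeffDual_scrollVector_of_ne] at this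
  · simpa using this
  · rintro ⟨rfl, h⟩; exact hne₂ (by rw [Nat.succ.inj h])
  · rintro ⟨rfl, h⟩; exact hne₁ (by rw [Nat.succ.inj h])

lemma ker_restriction_le_syzygySum (hk3 : 3 ≤ k 0 + k 1 + k 2)
    (hI : RingHom.ker (restriction x) ≤ I) : RingHom.ker (restriction x) ≤ syzygySum I := by
  rw [ker_restriction] at *
  refine Ideal.span_le.2 ?_
  rintro _ ⟨i, i', j, j', hj, hj', rfl⟩
  exact scrollMinor_mem_syzygySum x hk3 hI hj hj'

/-- Two quadrics whose restrictions to the scroll are in the ratio `s : t` are both involved in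
linear syzygies. -/
lemma mem_syzygySum_of_ratio (hk3 : 3 ≤ k 0 + k 1 + k 2)
    (hI : RingHom.ker (restriction x) ≤ I) {q q' : MvPolynomial (Fin g) ℂ}
    (hq : q ∈ quadrics I) (hq' : q' ∈ quadrics I)
    (h : X (Sum.inl 1) * restriction x q = X (Sum.inl 0) * restriction x q') :
    q ∈ syzygySum I ∧ q' ∈ syzygySum I := by
  obtain ⟨i, hi⟩ : ∃ i, 0 < k i := by
    by_contra! h0
    simp [Nat.le_zero.1 (h0 _)] at hk3
  have hker := ker_restriction_le_syzygySum x hk3 hI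
  rw [ker_restriction] at hker hI
  have hs : (monomial (sectionExponent k i 0) 1 : CoxRing) * X (Sum.inl 0) =
      monomial (sectionExponent k i 1) 1 * X (Sum.inl 1) := by
    simp only [X, monomial_mul, mul_one]
    refine congrArg (fun d => monomial d _) (Finsupp.ext fun v => ?_)
    rcases v with v | v
    · fin_cases v <;> simp; omega
    · simp
  -- The forms restricting to t^{k_i} y_i and s t^{k_i - 1} y_i are in the ratio t : s, inverse to
  -- that of q and q', so the cubic vanishes on the scroll.
  have hcubic : scrollForm x i 0 * q - scrollForm x i 1 * q' ∈
      Ideal.span (scrollMinors x) := by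
    rw [← ker_restriction, RingHom.mem_ker, map_sub, map_mul, map_mul,
      restriction_scrollForm x hi.le, restriction_scrollForm x hi]
    have h0 : (X (Sum.inl 0) : CoxRing) ≠ 0 := X_ne_zero _
    refine mul_left_cancel₀ h0 ?_
    linear_combination (restriction x q) * hs + (monomial (sectionExponent k i 1) 1) * h
  obtain ⟨δ, hδ, hδc⟩ := exists_multiplication_eq (I := I)
    (fun _ hf => hI (Ideal.subset_span hf))
    (fun _ hf => isHomogeneous_of_mem_scrollMinors x hf) hcubic
    (((scrollForm_isHomogeneous x hi.le).mul hq.2).sub ((scrollForm_isHomogeneous x hi).mul hq'.2))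
  -- Contracting with the coefficient of either linear form yields ± one quadric minus a combination
  -- of minors, and the minors are already known to be involved.
  have hγ : multiplication I
      (scrollVector x hi.le ⊗ₜ[ℂ] (⟨q, hq⟩ : quadrics I) -
        scrollVector x (Nat.succ_le_of_lt hi) ⊗ₜ[ℂ] (⟨q', hq'⟩ : quadrics I) - δ) = 0 := by
    simp only [map_sub, multiplication_tmul, hδ, scrollVector, sub_self]
  constructor
  · have h1 := contraction_mem_syzygySum hγ (coeffDual x (sectionExponent k i 0))
    rw [map_sub, map_sub, contraction_tmul, contraction_tmul, coeffDual_scrollVector_self,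
      coeffDual_scrollVector_of_ne x _ (by simp)] at h1
    simpa using add_mem h1 (hker (hδc (coeffDual x (sectionExponent k i 0))))
  · have h1 := contraction_mem_syzygySum hγ (coeffDual x (sectionExponent k i 1))
    rw [map_sub, map_sub, contraction_tmul, contraction_tmul,
      coeffDual_scrollVector_of_ne x _ (by simp)] at h1
    erw [coeffDual_scrollVector_self] at h1
    simpa using add_mem h1 (hker (hδc (coeffDual x (sectionExponent k i 1))))

/-- The exponent of the monomial `s ^ c * t ^ e`. -/
def fibreExponent (c e : ℕ) : Fin 2 ⊕ Fin 3 →₀ ℕ :=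
  Finsupp.single (Sum.inl 0) c + Finsupp.single (Sum.inl 1) e

variable (k) in
lemma monomial_fibreExponent_mem (c e : ℕ) :
    (monomial (fibreExponent c e) 1 : CoxRing) ∈ sections k 0 ((c + e : ℕ) : ℤ) := by
  convert monomial_mem_sections k (fibreExponent c e) 1 using 1
  simp [fibreExponent, hDegree, kDegree]

lemma monomial_fibreExponent_ratio (c e : ℕ) :
    (X (Sum.inl 1) * monomial (fibreExponent (c + 1) e) 1 : CoxRing) =
      X (Sum.inl 0) * monomial (fibreExponent c (e + 1)) 1 := by
  simp only [X, monomial_mul, mul_one, fibreExponent, Finsupp.single_add]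
  congr 1
  abel_nf

/-! ### Quadrics cutting out a divisor on the scroll -/

lemma ker_restriction_le_divisorIdeal (Q : CoxRing) :
    RingHom.ker (restriction x) ≤ divisorIdeal x Q := fun f hf => by
  rw [divisorIdeal, Ideal.mem_comap, (RingHom.mem_ker).1 hf]
  exact zero_mem _

lemma exists_quadric_lift {a : ℕ} {Q : CoxRing} (hQ : Q ∈ sections k 2 (-(a : ℤ)))
    (hI : divisorIdeal x Q ≤ I) {c e : ℕ} (hce : c + e = a) :
    ∃ q ∈ quadrics I, restriction x q = monomial (fibreExponent c e) 1 * Q := by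
  have hmem : monomial (fibreExponent c e) 1 * Q ∈ sections k (2 : ℕ) 0 := by
    have := IsWeightedHomogeneous.mul (monomial_fibreExponent_mem k c e) hQ
    rw [hce] at this
    simpa [sections] using this
  obtain ⟨q, hq, hqr⟩ := exists_restriction_eq x hmem
  refine ⟨q, ⟨hI ?_, hq⟩, hqr⟩
  rw [divisorIdeal, Ideal.mem_comap, hqr]
  exact Ideal.mul_mem_left _ _ (Ideal.mem_span_singleton_self Q)

/-- Since a > 0, every monomial s^c t^e of degree a can trade one s for a t or conversely, which
gives the partner needed for a ratio s : t. -/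
lemma exists_mem_syzygySum_lift (hk3 : 3 ≤ k 0 + k 1 + k 2) {a : ℕ} (ha : 0 < a) {Q : CoxRing}
    (hQ : Q ∈ sections k 2 (-(a : ℤ))) (hI : divisorIdeal x Q ≤ I) {c e : ℕ} (hce : c + e = a) :
    ∃ q ∈ syzygySum I, restriction x q = monomial (fibreExponent c e) 1 * Q := by
  have hker := (ker_restriction_le_divisorIdeal x Q).trans hI
  have key : ∀ c e : ℕ, c + e + 1 = a →
      (∃ q ∈ syzygySum I, restriction x q = monomial (fibreExponent (c + 1) e) 1 * Q) ∧
      ∃ q ∈ syzygySum I, restriction x q = monomial (fibreExponent c (e + 1)) 1 * Q := by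
    intro c e h
    obtain ⟨q, hq, hqr⟩ := exists_quadric_lift x hQ hI (c := c + 1) (e := e) (by omega)
    obtain ⟨q', hq', hqr'⟩ := exists_quadric_lift x hQ hI (c := c) (e := e + 1) (by omega)
    obtain ⟨h1, h2⟩ := mem_syzygySum_of_ratio x hk3 hker hq hq'
      (by rw [hqr, hqr', ← mul_assoc, ← mul_assoc, monomial_fibreExponent_ratio])
    exact ⟨⟨q, h1, hqr⟩, ⟨q', h2, hqr'⟩⟩
  rcases c with _ | c
  · obtain ⟨e, rfl⟩ : ∃ e', e = e' + 1 := ⟨e - 1, by omega⟩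
    exact (key 0 e (by omega)).2
  · exact (key c e (by omega)).1

/-! ### From these quadrics to the whole ideal of the divisor -/

/-- Only the F-degree is controlled: f need not be homogeneous, so its restriction may mix multiples
of H. -/
lemma restriction_isWeightedHomogeneous (f : MvPolynomial (Fin g) ℂ) :
    IsWeightedHomogeneous (fun v => (bidegree k v).2) (restriction x f) 0 := by
  induction f using MvPolynomial.induction_on with
  | C c =>
    rw [← algebraMap_eq, AlgHom.commutes, algebraMap_eq]
    exact isWeightedHomogeneous_C _ c
  | add p q hp hq => rw [map_add]; exact hp.add hq
  | mul_X p n hp =>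
    rw [map_mul, restriction_X]
    simpa using hp.mul (fibre_isWeightedHomogeneous k (x n).2)

lemma exists_mem_syzygySum_of_fibreDegree (hk3 : 3 ≤ k 0 + k 1 + k 2) {a : ℕ} (ha : 0 < a)
    {Q : CoxRing} (hQ : Q ∈ sections k 2 (-(a : ℤ))) (hI : divisorIdeal x Q ≤ I) {G : CoxRing}
    (hG : IsWeightedHomogeneous (fun v => (bidegree k v).2) G (a : ℤ)) :
    ∃ f ∈ syzygySum I, restriction x f = G * Q := by
  suffices h : G * Q ∈ ((syzygySum I).restrictScalars ℂ).map (restriction x).toLinearMap by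
    obtain ⟨f, hf, e⟩ := h
    exact ⟨f, hf, e⟩
  rw [G.as_sum, Finset.sum_mul]
  refine Submodule.sum_mem _ fun d hd => ?_
  have hw := hG (mem_support_iff.1 hd)
  rw [weight_fibre] at hw
  -- F-degree a makes the exponents of s and t sum to at least a. Removing s^c t^e leaves F-degree
  -- 0, which lifts to projective space, while s^c t^e Q lifts to an involved quadric.
  obtain ⟨c, e, hce, hc, he⟩ : ∃ c e, c + e = a ∧ c ≤ d (Sum.inl 0) ∧ e ≤ d (Sum.inl 1) :=
    ⟨min a (d (Sum.inl 0)), a - min a (d (Sum.inl 0)), by omega, by omega, by omega⟩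
  obtain ⟨d', rfl⟩ : ∃ d', d = fibreExponent c e + d' := exists_add_of_le fun v => by
    rcases v with v | v
    · fin_cases v <;> simpa [fibreExponent]
    · simp [fibreExponent]
  have hd' : d' (Sum.inl 0) + d' (Sum.inl 1) = kDegree k d' := by
    rw [kDegree_add] at hw
    have : kDegree k (fibreExponent c e) = 0 := by simp [fibreExponent, kDegree]
    rw [this] at hw
    simp [fibreExponent] at hw
    omega
  obtain ⟨f, -, hf⟩ := exists_restriction_eq_monomial x _ rfl hd'
  obtain ⟨q, hq, hqr⟩ := exists_mem_syzygySum_lift x hk3 ha hQ hI hce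
  refine ⟨coeff (fibreExponent c e + d') G • (f * q),
    Submodule.smul_mem _ _ (Ideal.mul_mem_left _ f hq), ?_⟩
  rw [AlgHom.toLinearMap_apply, map_smul, map_mul, hf, hqr, ← mul_assoc, monomial_mul,
    ← smul_mul_assoc, smul_monomial, mul_one, smul_eq_mul, mul_one, add_comm d']

theorem divisorIdeal_le_syzygySum (hk3 : 3 ≤ k 0 + k 1 + k 2) {a : ℕ} (ha : 0 < a) {Q : CoxRing}
    (hQ : Q ∈ sections k 2 (-(a : ℤ))) (hI : divisorIdeal x Q ≤ I) :
    divisorIdeal x Q ≤ syzygySum I := by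
  intro f hf
  obtain ⟨G, hG⟩ := Ideal.mem_span_singleton'.1 (Ideal.mem_comap.1 hf)
  -- The restriction of f has F-degree 0 and Q has F-degree -a, so only the component of G of
  -- F-degree a matters.
  have hGa : restriction x f =
      weightedHomogeneousComponent (fun v => (bidegree k v).2) (a : ℤ) G * Q := by
    rw [← weightedHomogeneousComponent_add_mul _ (fibre_isWeightedHomogeneous k hQ), hG,
      add_neg_cancel, (restriction_isWeightedHomogeneous x f).weightedHomogeneousComponent_same]
  obtain ⟨f', hf', e⟩ := exists_mem_syzygySum_of_fibreDegree x hk3 ha hQ hI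
    (weightedHomogeneousComponent_isWeightedHomogeneous (a : ℤ) G)
  have hker : f - f' ∈ RingHom.ker (restriction x) := by
    rw [RingHom.mem_ker, map_sub, e, hGa, sub_self]
  have := ker_restriction_le_syzygySum x hk3 ((ker_restriction_le_divisorIdeal x Q).trans hI) hker
  simpa using add_mem this hf'

end ScrollCurve
end

theorem mainTheorem5 (g : ℕ) (hg : 6 ≤ g) (k : Fin 3 → ℕ) (hk : Monotone k)
    (hkg : k 0 + k 1 + k 2 + 3 = g)
    (x : Module.Basis (Fin g) ℂ (ScrollCurve.sections k 1 0))
    (a b : ℕ) (hab : a + b + 5 = g)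
    (Q₁ Q₂ : ScrollCurve.CoxRing)
    (hQ₁ : Q₁ ∈ ScrollCurve.sections k 2 (-(a : ℤ))) (hQ₁0 : Q₁ ≠ 0)
    (hQ₂ : Q₂ ∈ ScrollCurve.sections k 2 (-(b : ℤ))) (hQ₂0 : Q₂ ≠ 0)
    (hC : ScrollCurve.IsNonsingularCurve (ScrollCurve.intersectionIdeal x Q₁ Q₂))
    (ha : 0 < a) (hb : 0 < b) :
    ScrollCurve.syz₂ (ScrollCurve.intersectionIdeal x Q₁ Q₂) =
      ScrollCurve.intersectionIdeal x Q₁ Q₂ := by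
  open ScrollCurve in
  have hle : divisorIdeal x Q₁ ⊔ divisorIdeal x Q₂ ≤ intersectionIdeal x Q₁ Q₂ :=
    le_saturation _
  refine le_antisymm ?_ (ScrollCurve.saturation_mono (sup_le ?_ ?_))
  · exact (ScrollCurve.saturation_mono ScrollCurve.syzygySum_le).trans
      (ScrollCurve.saturation_saturation _).le
  · exact ScrollCurve.divisorIdeal_le_syzygySum x (by omega) ha hQ₁ (le_sup_left.trans hle)
  · exact ScrollCurve.divisorIdeal_le_syzygySum x (by omega) hb hQ₂ (le_sup_right.trans hle)
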